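/- **Asymptotic $C^p$-continuity (jump decay) of the mesh-intrinsic GFEM with CWLS reconstruction.** *Mesh and shape functions.* Let $d,p\ge 0$ be integers, let $\Omega\subset\mathbb R^d$ be bounded and open, and fix finitely many reference Lagrange elements: each has a compact cell $\hat K=\overline{\operatorname{int}\hat K}$, nodes $\hat x_k\in\hat K$ and $C^\infty$ shape functions $\hat N_k$ with $\hat N_k(\hat x_l)=\delta_{kl}$ and $\sum_k\hat N_k=1$ on $\hat K$. Let $\mathcal T_h$ be a conforming finite element mesh of $\overline\Omega$ built from them: finitely many compact cells $K=\overline{\operatorname{int}K}$ with disjoint interiors and union $\overline\Omega$, smooth maps $G_K$ taking $K$ bijectively onto its reference cell, and nodes $\{x_i\}_{i\in\mathcal N}$, each of which is a local node of some cell; the global shape function $N_i$ equals, on every cell $K$, $\hat N_k\circ G_K$ if $x_i$ is the $k$-th local node of $K$ and $0$ if $x_i$ is not a local node of $K$, these prescriptions agreeing on intersections of cells, so that the $N_i$ are continuous on $\overline\Omega$ and $\sum_iN_i=1$ there. Let $h$ be the largest diameter of a cell. *Approximation.* Let $u\in C^{p+1}(\overline\Omega)$, i.e. $u$ is $C^{p+1}$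 on an open neighbourhood of $\overline\Omega$. For each node $i$ let $\omega_i\supseteq\operatorname{supp}N_i$ be a nodal patch, $\mathcal S_i=\{k: x_k\in\omega_i\}$, $\rho_i$ a patch radius, $w_{ik}$ ($k\in\mathcal S_i$) real weights, and let $U_i$ be the constrained weighted least-squares (CWLS) reconstruction of the nodal values of $u$: the polynomial of degree at most $p$, $U_i(x)=\sum_{|\gamma|\le p}a_{i,\gamma}\big((x-x_i)/\rho_i\big)^\gamma$, that minimizes $$\tfrac12\sum_{k\in\mathcal S_i}w_{ik}^2\,\big(U_i(x_k)-u(x_k)\big)^2\quad\text{subject to}\quad U_i(x_i)=u(x_i).$$ Put $u^h=\sum_{i\in\mathcal N}N_iU_i$. *Regularity, with constants $\kappa,\lambda>0$, $\bar w$, $M$ independent of $h$.* (a) The mesh is shape regular and quasi-uniform: $\|D^mG_K(x)\|\le\kappa h^{-m}$ for all cells $K$, $x\in K$, $1\le m\le p$. (b) The usual moving-least-squares assumptions hold: $\omega_i\subseteq\overline B(x_i,\rho_i)$, $h/\kappa\le\rho_i\le\kappa h$, $|\mathcal S_i|\le M$, $|w_{ik}|\le\bar w$, and uniform unisolvency,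 i.e. for all coefficient vectors $(a_\gamma)_{|\gamma|\le p}$, $$\sum_{k\in\mathcal S_i}w_{ik}^2\Big(\sum_{|\gamma|\le p}a_\gamma\big((x_k-x_i)/\rho_i\big)^\gamma\Big)^2\ \ge\ \lambda\sum_{|\gamma|\le p}a_\gamma^2 .$$ *Conclusion.* There is a constant $\widehat C$, depending only on $d$, $p$, $\Omega$, the reference elements, $u$, $\kappa,\lambda,\bar w$ and $M$ — in particular not on $h$ or on the mesh — such that for every such mesh and reconstruction, every two distinct cells $E^+,E^-$ with common boundary $\Gamma=\partial E^+\cap\partial E^-$, and every multi-index $\alpha$ with $|\alpha|\le p$, the one-sided limits of $D^\alpha u^h$ from the interiors of $E^+$ and $E^-$ exist at every point of $\Gamma$, and their difference, the jump $[\![D^\alpha u^h]\!]_\Gamma$, satisfies $$\big\|[\![D^\alpha u^h]\!]_\Gamma\big\|_{L^\infty(\Gamma)}\ \le\ \sup_{x\in\Gamma}\big|[\![D^\alpha u^h]\!]_\Gamma(x)\big|\ \le\ \widehat C\,h^{p+1-|\alpha|}.$$ -/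

import Mathlib

open Set Filter Topology
open scoped ContDiff

noncomputable section

/-- Points of `ℝ^d` with the Euclidean norm. -/
abbrev Pt (d : ℕ) : Type := EuclideanSpace ℝ (Fin d)

/-- The classical partial derivative `D^α f` of multi-index `α`: the Fréchet derivative of order
`|α| = ∑ i, α i`, evaluated at the list of basis vectors that contains `e_i` exactly `α i` times. -/
def multiDeriv {d : ℕ} (α : Fin d → ℕ) (f : Pt d → ℝ) (x : Pt d) : ℝ :=
  iteratedFDeriv ℝ (∑ i, α i) f x
    (fun j => EuclideanSpace.single (finSigmaFinEquiv.symm j).1 (1 : ℝ))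

/-- A reference Lagrange finite element: a compact cell with nodes and nodal shape functions
(smooth, Kronecker at the nodes, summing to one on the cell). -/
structure LagrangeCell (d : ℕ) where
  carrier : Set (Pt d)
  isCompact_carrier : IsCompact carrier
  closure_interior : closure (interior carrier) = carrier
  numNodes : ℕ
  node : Fin numNodes → Pt d
  node_mem : ∀ k, node k ∈ carrier
  shape : Fin numNodes → Pt d → ℝ
  contDiff_shape : ∀ k, ContDiff ℝ ∞ (shape k)
  shape_node : ∀ k l, shape k (node l) = if k = l then 1 else 0
  sum_shape : ∀ x ∈ carrier, ∑ k, shape k x = 1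

/-- A conforming `C⁰` Lagrange finite element mesh of `closure Ω` with reference cells `R`.
`chart K` is the inverse of the geometric map from the reference cell onto the cell `K`
(extended smoothly off the cell); `localNode K` is the local-to-global node numbering.
The global shape function `shape i` is, on *every* closed cell `K`, the pulled back reference shape
function of the local node of `K` with global number `i`, and zero if `K` has no such node. That the
prescriptions of two cells agree on their intersection is the conformity of the mesh. -/
structure FEMesh {d : ℕ} {ι : Type*} (R : ι → LagrangeCell d) (Ω : Set (Pt d)) where
  numCells : ℕ
  numNodes : ℕ
  kind : Fin numCells → ι
  cell : Fin numCells → Set (Pt d)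
  chart : Fin numCells → Pt d → Pt d
  node : Fin numNodes → Pt d
  localNode : (K : Fin numCells) → Fin (R (kind K)).numNodes → Fin numNodes
  shape : Fin numNodes → Pt d → ℝ
  isCompact_cell : ∀ K, IsCompact (cell K)
  closure_interior_cell : ∀ K, closure (interior (cell K)) = cell K
  iUnion_cell : ⋃ K, cell K = closure Ω
  disjoint_interior : Pairwise fun K L => Disjoint (interior (cell K)) (interior (cell L))
  contDiff_chart : ∀ K, ContDiff ℝ ∞ (chart K)
  bijOn_chart : ∀ K, BijOn (chart K) (cell K) (R (kind K)).carrier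
  node_injective : Function.Injective node
  node_localNode_mem : ∀ K k, node (localNode K k) ∈ cell K
  chart_node_localNode : ∀ K k, chart K (node (localNode K k)) = (R (kind K)).node k
  exists_localNode : ∀ i, ∃ K k, localNode K k = i
  shape_eq : ∀ i K, ∀ x ∈ cell K, shape i x =
    ∑ k with localNode K k = i, (R (kind K)).shape k (chart K x)

namespace FEMesh

variable {d : ℕ} {ι : Type*} {R : ι → LagrangeCell d} {Ω : Set (Pt d)}

/-- The mesh size: the largest diameter of a cell. -/
def meshSize (T : FEMesh R Ω) : ℝ := ⨆ K, Metric.diam (T.cell K)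

/-- The support patch `supp N_i` of the shape function of node `i`. -/
def suppPatch (T : FEMesh R Ω) (i : Fin T.numNodes) : Set (Pt d) :=
  closure {x | x ∈ closure Ω ∧ T.shape i x ≠ 0}

/-- The common boundary of two cells. -/
def interface (T : FEMesh R Ω) (K L : Fin T.numCells) : Set (Pt d) :=
  frontier (T.cell K) ∩ frontier (T.cell L)

/-- Shape regularity and quasi-uniformity up to order `p`: the derivatives of order `m` of the
inverse geometric maps are at most `κ h^{-m}`. For affine cells this says that `‖B⁻¹‖ ≤ κ / h` for
the linear parts `B` of the maps from the reference cells. -/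
def IsShapeRegular (T : FEMesh R Ω) (p : ℕ) (κ : ℝ) : Prop :=
  ∀ K, ∀ x ∈ T.cell K, ∀ m, 1 ≤ m → m ≤ p →
    ‖iteratedFDeriv ℝ m (T.chart K) x‖ ≤ κ / T.meshSize ^ m

end FEMesh

/-- Multi-indices `γ` in dimension `d` with `|γ| ≤ p`; they index the monomial basis of the
polynomials of degree at most `p`. -/
abbrev MultiIdx (d p : ℕ) : Type := {γ : Fin d → Fin (p + 1) // ∑ i, (γ i : ℕ) ≤ p}

/-- The polynomial `∑_γ a_γ ξ^γ` in the scaled local coordinates `ξ = (x - c) / ρ`. -/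
def scaledPoly {d p : ℕ} (c : Pt d) (ρ : ℝ) (a : MultiIdx d p → ℝ) (x : Pt d) : ℝ :=
  ∑ γ, a γ * ∏ i, ((x i - c i) / ρ) ^ (γ.1 i : ℕ)

/-- The reconstruction data of a mesh: for every node `i` a nodal patch containing the support
patch, a patch radius, and the weights of the sampling nodes. -/
structure PatchData {d : ℕ} {ι : Type*} {R : ι → LagrangeCell d} {Ω : Set (Pt d)}
    (T : FEMesh R Ω) where
  patch : Fin T.numNodes → Set (Pt d)
  radius : Fin T.numNodes → ℝ
  weight : Fin T.numNodes → Fin T.numNodes → ℝ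
  suppPatch_subset : ∀ i, T.suppPatch i ⊆ patch i

namespace PatchData

variable {d : ℕ} {ι : Type*} {R : ι → LagrangeCell d} {Ω : Set (Pt d)} {T : FEMesh R Ω}

open Classical in
/-- The patch node set `S_i`: the nodes that lie in the nodal patch of node `i`. -/
def stencil (P : PatchData T) (i : Fin T.numNodes) : Finset (Fin T.numNodes) :=
  {k | T.node k ∈ P.patch i}

/-- The weighted discrete least-squares functional of node `i` for nodal data `v`. -/
def objective {p : ℕ} (P : PatchData T) (i : Fin T.numNodes) (v : Fin T.numNodes → ℝ)
    (a : MultiIdx d p → ℝ) : ℝ :=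
  (1 / 2) * ∑ k ∈ P.stencil i,
    (P.weight i k * (scaledPoly (T.node i) (P.radius i) a (T.node k) - v k)) ^ 2

/-- `a` is the coefficient vector of the constrained weighted least-squares reconstruction at node
`i` from nodal data `v`: it minimizes the weighted least-squares functional among all polynomials of
degree at most `p` that interpolate the datum of the star node `i`. -/
def IsCWLS {p : ℕ} (P : PatchData T) (i : Fin T.numNodes) (v : Fin T.numNodes → ℝ)
    (a : MultiIdx d p → ℝ) : Prop :=
  scaledPoly (T.node i) (P.radius i) a (T.node i) = v i ∧
    ∀ b : MultiIdx d p → ℝ, scaledPoly (T.node i) (P.radius i) b (T.node i) = v i →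
      P.objective i v a ≤ P.objective i v b

/-- The usual moving-least-squares assumptions, with constants that do not see the mesh size `h`:
the nodal patches are contained in balls about their star nodes of radii comparable to `h`, the
stencils have at most `M` nodes, the weights are at most `wmax`, and the scaled moment matrices
`Pᵀ W² P` have smallest eigenvalue at least `lam` (uniform unisolvency). -/
structure IsRegular (P : PatchData T) (p : ℕ) (κ lam wmax : ℝ) (M : ℕ) : Prop where
  patch_subset : ∀ i, P.patch i ⊆ Metric.closedBall (T.node i) (P.radius i)
  radius_le : ∀ i, P.radius i ≤ κ * T.meshSize
  le_radius : ∀ i, T.meshSize ≤ κ * P.radius i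
  card_stencil_le : ∀ i, (P.stencil i).card ≤ M
  weight_le : ∀ i, ∀ k ∈ P.stencil i, |P.weight i k| ≤ wmax
  unisolvent : ∀ i, ∀ a : MultiIdx d p → ℝ, lam * ∑ γ, a γ ^ 2 ≤
    ∑ k ∈ P.stencil i, (P.weight i k * scaledPoly (T.node i) (P.radius i) a (T.node k)) ^ 2

/-- The global approximation `u^h = ∑_i N_i U_i` with `U_i` the polynomial of coefficients `a i`. -/
def globalApprox {p : ℕ} (P : PatchData T) (a : Fin T.numNodes → MultiIdx d p → ℝ)
    (x : Pt d) : ℝ :=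
  ∑ i, T.shape i x * scaledPoly (T.node i) (P.radius i) (a i) x

end PatchData

/-- The jump of `f` at `x` from the region `A` to the region `B` exists and equals `J`: both one-sided
limits, from the interior of `A` and from the interior of `B`, exist, and `J` is their difference. -/
def HasJump {d : ℕ} (f : Pt d → ℝ) (A B : Set (Pt d)) (x : Pt d) (J : ℝ) : Prop :=
  ∃ l r : ℝ, Tendsto f (𝓝[interior A] x) (𝓝 l) ∧ Tendsto f (𝓝[interior B] x) (𝓝 r) ∧ J = l - r

end

/-!
The jump is small because on each side of the interface the derivative `D^α u^h` is close to the same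
number, `D^α u`.

On a closed cell `K` the approximation `u^h` coincides with a function that is smooth on the whole
space, `∑_k (N̂_k ∘ G_K) U_{i(k)}` (`PatchData.cellApprox`). Hence the one-sided limits exist and are
the values of its derivatives, and it suffices to bound the derivatives of its difference from `u` on
`K` by `O(h^{p+1-|α|})` (`exists_norm_iteratedFDeriv_cellApprox_sub_le`). The shape functions sum to
one on `K`, so the difference is `∑_k (N̂_k ∘ G_K) (U_{i(k)} - u)`, and Leibniz' rule combines two
estimates.

* `exists_norm_iteratedFDeriv_localShape_le`: derivatives of order `m` of the shape functions are
  `O(h^{-m})`, by shape regularity.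
* `exists_norm_iteratedFDeriv_scaledPoly_sub_le`: derivatives of order `m` of `U_i - u` are
  `O(h^{p+1-m})` near the star node `x_i`. The Taylor polynomial of `u` at `x_i` is admissible in the
  constrained least-squares problem, so `U_i` is no farther from the data than it is; by unisolvency
  the scaled coefficients of the two polynomials differ by `O(h^{p+1})`
  (`PatchData.IsCWLS.lam_mul_sum_sq_sub_le`), and each derivative costs a factor `h^{-1}`
  (`exists_norm_iteratedFDeriv_scaledPoly_le`). The remaining part is Taylor's theorem for all
  derivatives (`norm_iteratedFDeriv_sub_taylorPoly_le`).

The segments that join a node to other points of a cell or stencil may leave the domain. Therefore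
`u` is replaced from the start by a function on the whole space with the same nodal values and a
bounded derivative of order `p + 1` (`ContDiffOn.exists_global_bounded`).
-/

/-! ### Taylor polynomials in normed spaces -/

section Taylor

variable {E F : Type*} [NormedAddCommGroup E] [NormedSpace ℝ E]
  [NormedAddCommGroup F] [NormedSpace ℝ F]

/-- Induction on the order. The transposition of the first two arguments is the symmetry of the second
derivative of the derivative of order `n`; any other one acts inside a derivative of lower order. -/
theorem iteratedFDeriv_comp_swap {n : ℕ} {f : E → F} (hf : ContDiff ℝ (n + 1 : ℕ) f) (x : E)
    (v : Fin (n + 1) → E) (i : Fin n) :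
    iteratedFDeriv ℝ (n + 1) f x (v ∘ Equiv.swap i.castSucc i.succ) =
      iteratedFDeriv ℝ (n + 1) f x v := by
  induction n generalizing x with
  | zero => exact i.elim0
  | succ n ih =>
    have hd : Differentiable ℝ (iteratedFDeriv ℝ (n + 1) f) :=
      hf.differentiable_iteratedFDeriv (by exact_mod_cast Nat.lt_succ_self (n + 1))
    refine Fin.cases ?_ (fun j => ?_) i
    · have hg : ContDiff ℝ 2 (iteratedFDeriv ℝ n f) :=
        hf.iteratedFDeriv_right (by norm_cast; omega)
      have hsymm : IsSymmSndFDerivAt ℝ (iteratedFDeriv ℝ n f) x :=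
        hg.contDiffAt.isSymmSndFDerivAt (by simp)
      have key : ∀ w : Fin (n + 2) → E, iteratedFDeriv ℝ (n + 2) f x w =
          fderiv ℝ (fderiv ℝ (iteratedFDeriv ℝ n f)) x (w 0) (w 1) (Fin.tail (Fin.tail w)) := by
        intro w
        have hg2 : DifferentiableAt ℝ (fderiv ℝ (iteratedFDeriv ℝ n f)) x :=
          ((hg.fderiv_right (m := 1) (by norm_num)).differentiable (by norm_num)) x
        rw [(hd x).iteratedFDeriv_succ_apply_left']
        have h1 : HasFDerivAt (fun y => fderiv ℝ (iteratedFDeriv ℝ n f) y (w 1))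
            ((fderiv ℝ (fderiv ℝ (iteratedFDeriv ℝ n f)) x).flip (w 1)) x := by
          simpa using hg2.hasFDerivAt.clm_apply (hasFDerivAt_const (w 1) x)
        exact congrArg (fun D => D (w 0))
          (h1.continuousMultilinear_apply_const (Fin.tail (Fin.tail w))).fderiv
      have ht : Fin.tail (Fin.tail (v ∘ Equiv.swap (Fin.castSucc 0) (Fin.succ 0))) =
          Fin.tail (Fin.tail v) := by
        funext k
        simp only [Fin.tail, Function.comp_apply]
        rw [Equiv.swap_apply_of_ne_of_ne] <;> simp [Fin.ext_iff]
      rw [key, key, ht]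
      simp only [Function.comp_apply]
      have h0 : Equiv.swap (Fin.castSucc 0) (Fin.succ 0) (0 : Fin (n + 2)) = 1 :=
        Equiv.swap_apply_left _ _
      have h1 : Equiv.swap (Fin.castSucc 0) (Fin.succ 0) (1 : Fin (n + 2)) = 0 :=
        Equiv.swap_apply_right _ _
      rw [h0, h1, hsymm.eq]
    · rw [(hd x).iteratedFDeriv_succ_apply_left', (hd x).iteratedFDeriv_succ_apply_left']
      have h0 : (v ∘ Equiv.swap j.succ.castSucc j.succ.succ) 0 = v 0 := by
        simp only [Function.comp_apply]
        rw [Equiv.swap_apply_of_ne_of_ne] <;> simp [Fin.ext_iff]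
      have ht : Fin.tail (v ∘ Equiv.swap j.succ.castSucc j.succ.succ) =
          Fin.tail v ∘ Equiv.swap j.castSucc j.succ := by
        funext k
        simp only [Fin.tail, Function.comp_apply]
        congr 1
        rw [← Fin.succ_castSucc]
        exact ((Fin.succ_injective _).swap_apply _ _ _)
      have hf' : ContDiff ℝ (n + 1 : ℕ) f := hf.of_le (by norm_cast; omega)
      rw [h0, ht]
      simp_rw [ih hf']

/-- Iterated derivatives of a function of finite smoothness are symmetric: adjacent transpositions,
which generate all permutations, are handled by the symmetry of second derivatives. -/
theorem ContDiff.iteratedFDeriv_comp_perm_real {n : ℕ} {f : E → F} (hf : ContDiff ℝ n f) (x : E)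
    (v : Fin n → E) (σ : Equiv.Perm (Fin n)) :
    iteratedFDeriv ℝ n f x (v ∘ σ) = iteratedFDeriv ℝ n f x v := by
  cases n with
  | zero => congr 1; exact Subsingleton.elim _ _
  | succ n =>
    have hσ : σ ∈ Submonoid.closure
        (Set.range fun i : Fin n => Equiv.swap i.castSucc i.succ) := by
      rw [Equiv.Perm.mclosure_swap_castSucc_succ]; trivial
    induction hσ using Submonoid.closure_induction generalizing v with
    | mem σ h => obtain ⟨i, rfl⟩ := h; exact iteratedFDeriv_comp_swap hf x v i
    | one => rfl
    | mul σ τ _ _ h1 h2 =>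
      rw [Equiv.Perm.coe_mul, ← Function.comp_assoc, h2, h1]

/-- The Taylor series of `f` at `c`, truncated after order `p`. -/
noncomputable def taylorSeries (f : E → F) (c : E) (p : ℕ) : FormalMultilinearSeries ℝ E F :=
  fun n => if n ≤ p then (n.factorial : ℝ)⁻¹ • iteratedFDeriv ℝ n f c else 0

/-- The Taylor polynomial of `f` at `c` of degree at most `p`. -/
noncomputable def taylorPoly (f : E → F) (c : E) (p : ℕ) (y : E) : F :=
  ∑ n ∈ Finset.range (p + 1), (n.factorial : ℝ)⁻¹ • iteratedFDeriv ℝ n f c (fun _ => y - c)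

theorem hasFiniteFPowerSeriesOnBall_taylorPoly (f : E → F) (c : E) (p : ℕ) :
    HasFiniteFPowerSeriesOnBall (taylorPoly f c p) (taylorSeries f c p) c (p + 1) ⊤ := by
  refine .mk' (fun m hm => ?_) (by simp) (fun y _ => ?_)
  · simp [taylorSeries, show ¬ m ≤ p by omega]
  · refine Finset.sum_congr rfl fun i hi => ?_
    have hi' : i ≤ p := Nat.lt_succ_iff.mp (Finset.mem_range.mp hi)
    simp [taylorSeries, hi']

theorem analyticOn_taylorPoly (f : E → F) (c : E) (p : ℕ) :
    AnalyticOn ℝ (taylorPoly f c p) univ := by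
  have h := (hasFiniteFPowerSeriesOnBall_taylorPoly f c p).cpolynomialOn.analyticOn
  simpa using h

theorem contDiff_taylorPoly [CompleteSpace F] (f : E → F) (c : E) (p : ℕ) {n : ℕ∞ω} :
    ContDiff ℝ n (taylorPoly f c p) := by
  rw [← contDiffOn_univ]
  exact (analyticOn_taylorPoly f c p).contDiffOn uniqueDiffOn_univ

theorem iteratedFDeriv_taylorPoly_center {f : E → F} (c : E) {p m : ℕ} (hf : ContDiff ℝ m f)
    (hm : m ≤ p) : iteratedFDeriv ℝ m (taylorPoly f c p) c = iteratedFDeriv ℝ m f c := by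
  ext v
  rw [(hasFiniteFPowerSeriesOnBall_taylorPoly f c p).toHasFPowerSeriesOnBall.iteratedFDeriv_eq_sum
    (analyticOn_taylorPoly f c p)]
  have h : ∀ σ : Equiv.Perm (Fin m), taylorSeries f c p m (fun i => v (σ i)) =
      (m.factorial : ℝ)⁻¹ • iteratedFDeriv ℝ m f c v := fun σ => by
    simp only [taylorSeries, if_pos hm, smul_apply]
    exact congrArg _ (hf.iteratedFDeriv_comp_perm_real c v σ)
  simp_rw [h]
  rw [Finset.sum_const, Finset.card_univ, Fintype.card_perm, Fintype.card_fin,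
    ← Nat.cast_smul_eq_nsmul ℝ, smul_smul, mul_inv_cancel₀ (by positivity), one_smul]

theorem iteratedFDeriv_taylorPoly_eq_zero (f : E → F) (c y : E) (p : ℕ) :
    iteratedFDeriv ℝ (p + 1) (taylorPoly f c p) y = 0 := by
  have h := (hasFiniteFPowerSeriesOnBall_taylorPoly f c p).changeOrigin (y := y - c) (by simp)
  rw [add_sub_cancel] at h
  ext v
  rw [h.toHasFPowerSeriesOnBall.iteratedFDeriv_eq_sum (analyticOn_taylorPoly f c p),
    h.finite _ le_rfl]
  simp

/-- Taylor's theorem for all derivatives up to order `p`. The difference from the Taylor polynomial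
has vanishing derivatives at the centre, and the bound on the derivative of order `p + 1` descends
one order at a time by the mean value inequality. -/
theorem norm_iteratedFDeriv_sub_taylorPoly_le [CompleteSpace F] {f : E → F} {p : ℕ}
    (hf : ContDiff ℝ (p + 1 : ℕ) f) {B : ℝ} (hB : ∀ x, ‖iteratedFDeriv ℝ (p + 1) f x‖ ≤ B)
    (c y : E) {m : ℕ} (hm : m ≤ p + 1) :
    ‖iteratedFDeriv ℝ m (f - taylorPoly f c p) y‖ ≤ B * ‖y - c‖ ^ (p + 1 - m) := by
  have hT : ∀ m : ℕ, ContDiff ℝ m (taylorPoly f c p) := fun m => contDiff_taylorPoly f c p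
  have hr : ContDiff ℝ (p + 1 : ℕ) (f - taylorPoly f c p) := hf.sub (hT _)
  have hB0 : 0 ≤ B := (norm_nonneg _).trans (hB c)
  induction hm using Nat.decreasingInduction generalizing y with
  | self =>
    rw [iteratedFDeriv_sub_apply hf.contDiffAt (hT _).contDiffAt,
      iteratedFDeriv_taylorPoly_eq_zero]
    simpa using hB y
  | of_succ m hm ih =>
    have hc : iteratedFDeriv ℝ m (f - taylorPoly f c p) c = 0 := by
      have hfm : ContDiff ℝ m f := hf.of_le (by norm_cast; omega)
      rw [iteratedFDeriv_sub_apply hfm.contDiffAt (hT _).contDiffAt,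
        iteratedFDeriv_taylorPoly_center c hfm (by omega), sub_self]
    have hdiff : Differentiable ℝ (iteratedFDeriv ℝ m (f - taylorPoly f c p)) :=
      hr.differentiable_iteratedFDeriv (by exact_mod_cast hm)
    have := (convex_closedBall c ‖y - c‖).norm_image_sub_le_of_norm_fderiv_le
      (f := iteratedFDeriv ℝ m (f - taylorPoly f c p))
      (C := B * ‖y - c‖ ^ (p + 1 - (m + 1))) (x := c) (y := y) (fun z _ => hdiff z)
      (fun z hz => by
        rw [norm_fderiv_iteratedFDeriv]
        have hz' : ‖z - c‖ ≤ ‖y - c‖ := by simpa [dist_eq_norm] using hz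
        exact (ih z).trans (by gcongr))
      (by simp) (by simp [dist_eq_norm])
    rw [hc, sub_zero] at this
    refine this.trans_eq ?_
    rw [mul_assoc, ← pow_succ]
    congr 2
    omega

end Taylor

/-! ### Bounds for iterated derivatives -/

section Bounds

variable {E F : Type*} [NormedAddCommGroup E] [NormedSpace ℝ E]
  [NormedAddCommGroup F] [NormedSpace ℝ F]

theorem exists_bound_iteratedFDeriv {ι : Type*} [Finite ι] {g : ι → E → F}
    (hg : ∀ i, ContDiff ℝ ∞ (g i)) {K : ι → Set E} (hK : ∀ i, IsCompact (K i)) (n : ℕ) :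
    ∃ C, 0 ≤ C ∧ ∀ i, ∀ m ≤ n, ∀ x ∈ K i, ‖iteratedFDeriv ℝ m (g i) x‖ ≤ C := by
  have h : ∀ j : ι × Fin (n + 1), ∃ C, ∀ x ∈ K j.1, ‖iteratedFDeriv ℝ j.2 (g j.1) x‖ ≤ C :=
    fun j => (hK j.1).exists_bound_of_continuousOn
      ((hg j.1).continuous_iteratedFDeriv (by exact_mod_cast le_top)).continuousOn
  choose C hC using h
  obtain ⟨B, hB⟩ := (Set.finite_range C).bddAbove
  refine ⟨max B 0, le_max_right _ _, fun i m hm x hx => ?_⟩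
  exact (hC (i, ⟨m, by omega⟩) x hx).trans ((hB ⟨_, rfl⟩).trans (le_max_left _ _))

/-- A function of class `C^n` near a compact set agrees there with a compactly supported function of
class `C^n` on the whole space, whose derivative of order `n` is therefore bounded. Thus no convexity
of the domain is needed in Taylor's theorem. -/
theorem ContDiffOn.exists_global_bounded [FiniteDimensional ℝ E] {n : ℕ} {f : E → ℝ} {K V : Set E}
    (hV : IsOpen V) (hK : IsCompact K) (hKV : K ⊆ V) (hf : ContDiffOn ℝ n f V) :
    ∃ g : E → ℝ, ContDiff ℝ n g ∧ EqOn g f K ∧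
      ∃ B, ∀ x, ‖iteratedFDeriv ℝ n g x‖ ≤ B := by
  obtain ⟨K', hK', hKK', hK'V⟩ := exists_compact_between hK hV hKV
  obtain ⟨χ, h1, h0, -⟩ := exists_contMDiffMap_one_nhds_of_subset_interior
    (modelWithCornersSelf ℝ E) (n := (⊤ : ℕ∞)) hK.isClosed hKK'
  have hχ : ContDiff ℝ n χ :=
    (contMDiff_iff_contDiff.mp χ.contMDiff).of_le (by exact_mod_cast le_top)
  have hg : ContDiff ℝ n (fun x => χ x * f x) := by
    rw [contDiff_iff_contDiffAt]
    intro x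
    by_cases hx : x ∈ V
    · exact hχ.contDiffAt.mul (hf.contDiffAt (hV.mem_nhds hx))
    · have : (fun x => χ x * f x) =ᶠ[𝓝 x] fun _ => 0 := by
        filter_upwards [hK'.isClosed.isOpen_compl.mem_nhds fun h => hx (hK'V h)] with y hy
        rw [h0 y hy, zero_mul]
      exact contDiffAt_const.congr_of_eventuallyEq this
  have hc : HasCompactSupport (fun x => χ x * f x) :=
    HasCompactSupport.intro hK' fun x hx => by rw [h0 x hx, zero_mul]
  refine ⟨_, hg, fun x hx => ?_, ?_⟩
  · have : χ x = 1 := h1.self_of_nhdsSet x hx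
    simp [this]
  · exact (hc.iteratedFDeriv n).exists_bound_of_continuous (hg.continuous_iteratedFDeriv le_rfl)

end Bounds

/-! ### Scaled polynomials -/

section ScaledPoly

variable {d p : ℕ}

theorem scaledPoly_sub (c : Pt d) (ρ : ℝ) (a b : MultiIdx d p → ℝ) :
    scaledPoly c ρ (a - b) = scaledPoly c ρ a - scaledPoly c ρ b := by
  funext x
  simp [scaledPoly, sub_mul, Finset.sum_sub_distrib]

/-- The scaled polynomial of a coefficient vector, as a linear map. -/
noncomputable def scaledPolyLinear (p : ℕ) (c : Pt d) (ρ : ℝ) :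
    (MultiIdx d p → ℝ) →ₗ[ℝ] Pt d → ℝ where
  toFun := scaledPoly c ρ
  map_add' a b := by funext x; simp [scaledPoly, add_mul, Finset.sum_add_distrib]
  map_smul' r a := by funext x; simp [scaledPoly, Finset.mul_sum, mul_assoc]

theorem prod_coord_mem_range_scaledPolyLinear (c : Pt d) {ρ : ℝ} (hρ : ρ ≠ 0) {n : ℕ} (hn : n ≤ p)
    (r : Fin n → Fin d) :
    (fun y : Pt d => ∏ j, (y (r j) - c (r j))) ∈ LinearMap.range (scaledPolyLinear p c ρ) := by
  classical
  -- The exponent of a coordinate is the number of times it occurs in the product.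
  let e : Fin d → ℕ := fun i => (Finset.univ.filter fun j => r j = i).card
  have he : ∑ i, e i = n := by
    rw [← Finset.card_eq_sum_card_fiberwise (fun j _ => Finset.mem_coe.2 (Finset.mem_univ (r j)))]
    simp
  have hei : ∀ i, e i < p + 1 := fun i =>
    Nat.lt_succ_of_le (((Finset.single_le_sum (fun _ _ => Nat.zero_le _) (Finset.mem_univ i)).trans
      he.le).trans hn)
  let γ : MultiIdx d p := ⟨fun i => ⟨e i, hei i⟩, by simpa [he] using hn⟩
  have hmono : scaledPolyLinear p c ρ (Pi.single γ 1) =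
      fun y => ∏ j, ((y (r j) - c (r j)) / ρ) := by
    funext y
    have : ∀ δ : MultiIdx d p, δ ≠ γ → (Pi.single γ (1 : ℝ) : MultiIdx d p → ℝ) δ *
        ∏ i, ((y i - c i) / ρ) ^ (δ.1 i : ℕ) = 0 := fun δ hδ => by
      rw [Pi.single_eq_of_ne hδ, zero_mul]
    change scaledPoly c ρ (Pi.single γ 1) y = _
    rw [scaledPoly, Fintype.sum_eq_single γ this, Pi.single_eq_same, one_mul,
      ← Finset.prod_fiberwise (s := Finset.univ) (g := r)]
    refine Finset.prod_congr rfl fun i _ => ?_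
    rw [Finset.prod_congr rfl (g := fun _ => (y i - c i) / ρ), Finset.prod_const]
    intro j hj
    rw [(Finset.mem_filter.mp hj).2]
  refine ⟨ρ ^ n • Pi.single γ 1, ?_⟩
  rw [map_smul, hmono]
  funext y
  simp [Finset.prod_div_distrib, field]

/-- A Taylor polynomial is a polynomial in the scaled local coordinates: expand the derivatives,
which are multilinear forms, in the standard basis. -/
theorem exists_scaledPoly_eq_taylorPoly (f : Pt d → ℝ) (c : Pt d) {ρ : ℝ} (hρ : ρ ≠ 0) :
    ∃ t : MultiIdx d p → ℝ, scaledPoly c ρ t = taylorPoly f c p := by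
  suffices h : taylorPoly f c p ∈ LinearMap.range (scaledPolyLinear p c ρ) from h
  have hsum : taylorPoly f c p = ∑ n ∈ Finset.range (p + 1), ∑ r : Fin n → Fin d,
      ((n.factorial : ℝ)⁻¹ * iteratedFDeriv ℝ n f c fun j => EuclideanSpace.single (r j) 1) •
        fun y : Pt d => ∏ j, (y (r j) - c (r j)) := by
    funext y
    rw [taylorPoly, Finset.sum_apply]
    refine Finset.sum_congr rfl fun n _ => ?_
    have hy : y - c = ∑ i, (y i - c i) • EuclideanSpace.single i (1 : ℝ) := by
      ext i
      simp [Finset.sum_apply, Pi.single_apply]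
    rw [hy, ContinuousMultilinearMap.map_sum, Finset.sum_apply, Finset.smul_sum]
    refine Finset.sum_congr rfl fun r _ => ?_
    rw [ContinuousMultilinearMap.map_smul_univ]
    simp only [Pi.smul_apply, smul_eq_mul]
    ring
  rw [hsum]
  exact Submodule.sum_mem _ fun n hn => Submodule.sum_mem _ fun r _ => Submodule.smul_mem _ _ <|
    prod_coord_mem_range_scaledPolyLinear c hρ (Nat.lt_succ_iff.mp (Finset.mem_range.mp hn)) r

theorem contDiff_scaledPoly (c : Pt d) (ρ : ℝ) (a : MultiIdx d p → ℝ) {n : ℕ∞ω} :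
    ContDiff ℝ n (scaledPoly c ρ a) := by
  unfold scaledPoly
  fun_prop

/-- Inverse estimate for scaled polynomials: a derivative of order `m` costs a factor `ρ^{-m}`. -/
theorem exists_norm_iteratedFDeriv_scaledPoly_le (d p : ℕ) (κ : ℝ) :
    ∃ C, 0 ≤ C ∧ ∀ (c : Pt d) (ρ : ℝ) (a : MultiIdx d p → ℝ) (y : Pt d) (m : ℕ), 0 < ρ → m ≤ p →
      ‖y - c‖ ≤ κ * ρ →
        ‖iteratedFDeriv ℝ m (scaledPoly c ρ a) y‖ ≤ C * (∑ γ, |a γ|) * (ρ⁻¹) ^ m := by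
  let mono : MultiIdx d p → Pt d → ℝ := fun γ x => ∏ i, x i ^ (γ.1 i : ℕ)
  have hmono : ∀ γ, ContDiff ℝ ∞ (mono γ) := fun γ => by fun_prop
  obtain ⟨C, hC0, hC⟩ := exists_bound_iteratedFDeriv hmono
    (fun _ => isCompact_closedBall (0 : Pt d) κ) p
  refine ⟨C, hC0, fun c ρ a y m hρ hm hy => ?_⟩
  let L : Pt d →L[ℝ] Pt d := ρ⁻¹ • ContinuousLinearMap.id ℝ (Pt d)
  have hL : ‖L‖ ≤ ρ⁻¹ := by
    refine (norm_smul_le ρ⁻¹ (ContinuousLinearMap.id ℝ (Pt d))).trans ?_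
    rw [Real.norm_of_nonneg (inv_nonneg.2 hρ.le)]
    exact mul_le_of_le_one_right (inv_nonneg.2 hρ.le) ContinuousLinearMap.norm_id_le
  let g : Pt d → ℝ := ∑ γ, a γ • mono γ
  have hsm : ∀ γ, ContDiff ℝ m (a γ • mono γ) := fun γ =>
    ((hmono γ).of_le (by exact_mod_cast le_top)).const_smul (a γ)
  have hg : ContDiff ℝ m g := by
    have : g = fun x => ∑ γ, (a γ • mono γ) x := by funext x; simp [g]
    rw [this]
    exact ContDiff.sum fun γ _ => hsm γ
  have hcomp : scaledPoly c ρ a = fun x => (g ∘ L) (x - c) := by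
    funext x
    simp [scaledPoly, g, mono, L, div_eq_inv_mul]
  have hmem : L (y - c) ∈ Metric.closedBall (0 : Pt d) κ := by
    rw [mem_closedBall_zero_iff]
    refine (L.le_of_opNorm_le hL _).trans ?_
    rw [inv_mul_le_iff₀ hρ, mul_comm]
    exact hy
  have hgb : ‖iteratedFDeriv ℝ m g (L (y - c))‖ ≤ C * ∑ γ, |a γ| := by
    have : iteratedFDeriv ℝ m g (L (y - c)) =
        ∑ γ, a γ • iteratedFDeriv ℝ m (mono γ) (L (y - c)) := by
      have h := iteratedFDeriv_sum (𝕜 := ℝ) (u := Finset.univ) (i := m)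
        (f := fun γ => a γ • mono γ) fun γ _ => hsm γ
      have hg' : g = fun x => ∑ γ, (a γ • mono γ) x := by funext x; simp [g]
      rw [hg', h, Finset.sum_apply]
      refine Finset.sum_congr rfl fun γ _ => ?_
      exact iteratedFDeriv_const_smul_apply ((hmono γ).of_le (by exact_mod_cast le_top)).contDiffAt
    rw [this, Finset.mul_sum]
    refine (norm_sum_le _ _).trans (Finset.sum_le_sum fun γ _ => ?_)
    rw [norm_smul, Real.norm_eq_abs, mul_comm]
    exact mul_le_mul_of_nonneg_right (hC γ m hm _ hmem) (abs_nonneg _)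
  rw [hcomp, iteratedFDeriv_comp_sub, L.iteratedFDeriv_comp_right hg _ le_rfl]
  refine (ContinuousMultilinearMap.norm_compContinuousLinearMap_le _ _).trans ?_
  rw [Finset.prod_const, Finset.card_univ, Fintype.card_fin]
  have := pow_le_pow_left₀ (norm_nonneg L) hL m
  gcongr

end ScaledPoly

/-! ### The local reconstructions -/

section Reconstruction

variable {d p : ℕ} {ι : Type*} {R : ι → LagrangeCell d} {Ω : Set (Pt d)}

theorem FEMesh.diam_cell_le_meshSize (T : FEMesh R Ω) (K : Fin T.numCells) :
    Metric.diam (T.cell K) ≤ T.meshSize :=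
  le_ciSup (f := fun K => Metric.diam (T.cell K)) (Set.finite_range _).bddAbove K

theorem FEMesh.cell_subset_closure (T : FEMesh R Ω) (K : Fin T.numCells) :
    T.cell K ⊆ closure Ω :=
  T.iUnion_cell ▸ subset_iUnion T.cell K

theorem FEMesh.node_mem_closure (T : FEMesh R Ω) (i : Fin T.numNodes) :
    T.node i ∈ closure Ω := by
  obtain ⟨K, k, rfl⟩ := T.exists_localNode i
  exact T.cell_subset_closure K (T.node_localNode_mem K k)

variable {T : FEMesh R Ω} {P : PatchData T}

/-- The constrained minimizer is no worse than any competitor with the same value at the star node.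
If the competitor matches the data up to `ε` on the stencil, the minimizer therefore differs from it
on the stencil by `O(ε)` in the weighted norm, and unisolvency carries this over to the
coefficients. -/
theorem PatchData.IsCWLS.lam_mul_sum_sq_sub_le {κ lam wmax : ℝ} {M : ℕ}
    (hP : P.IsRegular p κ lam wmax M) {i : Fin T.numNodes} {v : Fin T.numNodes → ℝ}
    {a t : MultiIdx d p → ℝ} (ha : P.IsCWLS i v a)
    (ht : scaledPoly (T.node i) (P.radius i) t (T.node i) = v i) {ε : ℝ}
    (hε : ∀ k ∈ P.stencil i, |scaledPoly (T.node i) (P.radius i) t (T.node k) - v k| ≤ ε) :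
    lam * ∑ γ, (a - t) γ ^ 2 ≤ 4 * (M * (wmax * ε) ^ 2) := by
  have hmin := ha.2 t ht
  simp only [PatchData.objective] at hmin
  have hterm : ∀ k ∈ P.stencil i,
      (P.weight i k * (scaledPoly (T.node i) (P.radius i) t (T.node k) - v k)) ^ 2 ≤
        (wmax * ε) ^ 2 := fun k hk => by
    rw [← sq_abs, abs_mul]
    have hw := hP.weight_le i k hk
    have := mul_le_mul hw (hε k hk) (abs_nonneg _) ((abs_nonneg _).trans hw)
    gcongr
  have hsum : ∑ k ∈ P.stencil i,
      (P.weight i k * (scaledPoly (T.node i) (P.radius i) t (T.node k) - v k)) ^ 2 ≤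
        M * (wmax * ε) ^ 2 := by
    refine (Finset.sum_le_card_nsmul _ _ _ hterm).trans ?_
    rw [nsmul_eq_mul]
    have : ((P.stencil i).card : ℝ) ≤ M := by exact_mod_cast hP.card_stencil_le i
    gcongr
  calc lam * ∑ γ, (a - t) γ ^ 2
      ≤ ∑ k ∈ P.stencil i,
          (P.weight i k * scaledPoly (T.node i) (P.radius i) (a - t) (T.node k)) ^ 2 :=
        hP.unisolvent i (a - t)
    _ ≤ ∑ k ∈ P.stencil i,
          (2 * (P.weight i k * (scaledPoly (T.node i) (P.radius i) a (T.node k) - v k)) ^ 2 +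
          2 * (P.weight i k * (scaledPoly (T.node i) (P.radius i) t (T.node k) - v k)) ^ 2) := by
        refine Finset.sum_le_sum fun k _ => ?_
        rw [scaledPoly_sub, Pi.sub_apply]
        nlinarith [sq_nonneg (P.weight i k * (scaledPoly (T.node i) (P.radius i) a (T.node k) - v k)
          + P.weight i k * (scaledPoly (T.node i) (P.radius i) t (T.node k) - v k))]
    _ ≤ 4 * (M * (wmax * ε) ^ 2) := by
        rw [Finset.sum_add_distrib, ← Finset.mul_sum, ← Finset.mul_sum]
        linarith

/-- Every local reconstruction approximates `u` together with its derivatives at the optimal order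
on the cells around its star node. The comparison is with the Taylor polynomial at that node. -/
theorem exists_norm_iteratedFDeriv_scaledPoly_sub_le {u : Pt d → ℝ}
    (hu : ContDiff ℝ (p + 1 : ℕ) u) {B : ℝ} (hB : ∀ x, ‖iteratedFDeriv ℝ (p + 1) u x‖ ≤ B)
    {κ lam : ℝ} (wmax : ℝ) (M : ℕ) (hκ : 0 < κ) (hlam : 0 < lam) :
    ∃ C, 0 ≤ C ∧ ∀ (T : FEMesh R Ω) (P : PatchData T), P.IsRegular p κ lam wmax M →
      0 < T.meshSize → ∀ (i : Fin T.numNodes) (a : MultiIdx d p → ℝ),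
        P.IsCWLS i (fun k => u (T.node k)) a → ∀ y, ‖y - T.node i‖ ≤ T.meshSize → ∀ m ≤ p,
          ‖iteratedFDeriv ℝ m (scaledPoly (T.node i) (P.radius i) a - u) y‖ ≤
            C * T.meshSize ^ (p + 1 - m) := by
  obtain ⟨C₁, hC₁, hpoly⟩ := exists_norm_iteratedFDeriv_scaledPoly_le d p κ
  have hB0 : 0 ≤ B := (norm_nonneg _).trans (hB 0)
  let A : ℝ := Fintype.card (MultiIdx d p) * (4 * (M * wmax ^ 2) / lam)
  let C₂ : ℝ := √A * (B * κ ^ (p + 1))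
  have hA : 0 ≤ A := by positivity
  have hC₂ : 0 ≤ C₂ := by positivity
  refine ⟨C₁ * C₂ * max κ 1 ^ p + B, by positivity, fun T P hP hh i a ha y hy m hm => ?_⟩
  set h := T.meshSize
  set ρ := P.radius i
  set c := T.node i
  have hhρ : h ≤ κ * ρ := hP.le_radius i
  have hρ : 0 < ρ := pos_of_mul_pos_right (hh.trans_le hhρ) hκ.le
  obtain ⟨t, ht⟩ := exists_scaledPoly_eq_taylorPoly (p := p) u c hρ.ne'
  have hrem : ∀ z : Pt d, ∀ m ≤ p + 1,
      ‖iteratedFDeriv ℝ m (u - taylorPoly u c p) z‖ ≤ B * ‖z - c‖ ^ (p + 1 - m) :=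
    fun z m hm => norm_iteratedFDeriv_sub_taylorPoly_le hu hB c z hm
  have hval : ∀ z, |taylorPoly u c p z - u z| ≤ B * ‖z - c‖ ^ (p + 1) := fun z => by
    have := hrem z 0 (Nat.zero_le _)
    rw [norm_iteratedFDeriv_zero, Real.norm_eq_abs, Pi.sub_apply, abs_sub_comm] at this
    exact this
  have hcen : taylorPoly u c p c = u c := by
    have := hval c
    rw [sub_self, norm_zero, zero_pow (Nat.succ_ne_zero p), mul_zero] at this
    exact sub_eq_zero.mp (abs_nonpos_iff.mp this)
  have hcoef : ∑ γ, |(a - t) γ| ≤ C₂ * h ^ (p + 1) := by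
    have hq := ha.lam_mul_sum_sq_sub_le hP (t := t) (ε := B * (κ * h) ^ (p + 1))
      (by rw [ht]; exact hcen) fun k hk => by
        rw [ht]
        have hk' : ‖T.node k - c‖ ≤ ρ := by
          have hmem : T.node k ∈ P.patch i := by simpa [PatchData.stencil] using hk
          simpa [dist_eq_norm] using hP.patch_subset i hmem
        have hk'' := hk'.trans (hP.radius_le i)
        exact (hval _).trans (by gcongr)
    have hq' : ∑ γ, (a - t) γ ^ 2 ≤ 4 * (M * wmax ^ 2) / lam * (B * (κ * h) ^ (p + 1)) ^ 2 := by
      rw [div_mul_eq_mul_div, le_div_iff₀ hlam]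
      linarith
    have hcs : (∑ γ, |(a - t) γ|) ^ 2 ≤ Fintype.card (MultiIdx d p) * ∑ γ, (a - t) γ ^ 2 := by
      simpa using sq_sum_le_card_mul_sum_sq (s := Finset.univ) (f := fun γ => |(a - t) γ|)
    have hsq : (∑ γ, |(a - t) γ|) ^ 2 ≤ (C₂ * h ^ (p + 1)) ^ 2 := by
      calc (∑ γ, |(a - t) γ|) ^ 2
          ≤ Fintype.card (MultiIdx d p) *
              (4 * (M * wmax ^ 2) / lam * (B * (κ * h) ^ (p + 1)) ^ 2) := hcs.trans (by gcongr)
        _ = A * (B * (κ * h) ^ (p + 1)) ^ 2 := by ring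
        _ = √A ^ 2 * (B * (κ * h) ^ (p + 1)) ^ 2 := by rw [Real.sq_sqrt hA]
        _ = (C₂ * h ^ (p + 1)) ^ 2 := by simp only [C₂]; ring
    exact (sq_le_sq₀ (Finset.sum_nonneg fun _ _ => abs_nonneg _) (by positivity)).mp hsq
  have hsplit : scaledPoly c ρ a - u = scaledPoly c ρ (a - t) - (u - taylorPoly u c p) := by
    rw [scaledPoly_sub, ht]
    abel
  have hr : ContDiff ℝ m (u - taylorPoly u c p) :=
    (hu.of_le (by norm_cast; omega)).sub (contDiff_taylorPoly u c p)
  have hρinv : ρ⁻¹ ≤ κ * h⁻¹ := by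
    rw [← div_eq_mul_inv, le_div_iff₀ hh, inv_mul_le_iff₀ hρ, mul_comm]
    exact hhρ
  have hpow : h ^ (p + 1) * (h⁻¹) ^ m = h ^ (p + 1 - m) := by
    rw [inv_pow, pow_sub₀ h hh.ne' (by omega)]
  have hκm : κ ^ m ≤ max κ 1 ^ p :=
    (pow_le_pow_left₀ hκ.le (le_max_left _ _) m).trans (pow_le_pow_right₀ (le_max_right _ _) hm)
  rw [hsplit, iteratedFDeriv_sub_apply (contDiff_scaledPoly _ _ _).contDiffAt
    hr.contDiffAt]
  refine (norm_sub_le _ _).trans ?_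
  rw [add_mul]
  refine add_le_add ?_ ((hrem y m (by omega)).trans (by gcongr))
  calc ‖iteratedFDeriv ℝ m (scaledPoly c ρ (a - t)) y‖
      ≤ C₁ * (∑ γ, |(a - t) γ|) * (ρ⁻¹) ^ m := hpoly c ρ _ y m hρ hm (hy.trans hhρ)
    _ ≤ C₁ * (C₂ * h ^ (p + 1)) * (κ * h⁻¹) ^ m := by gcongr
    _ = C₁ * C₂ * κ ^ m * (h ^ (p + 1) * (h⁻¹) ^ m) := by ring
    _ ≤ C₁ * C₂ * max κ 1 ^ p * h ^ (p + 1 - m) := by rw [hpow]; gcongr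

end Reconstruction

/-! ### One cell -/

section Cell

variable {d p : ℕ} {ι : Type*} {R : ι → LagrangeCell d} {Ω : Set (Pt d)}

/-- The pulled back reference shape function of local node `k` on the cell `K`, as a smooth function
on the whole space. -/
noncomputable def FEMesh.localShape (T : FEMesh R Ω) (K : Fin T.numCells)
    (k : Fin (R (T.kind K)).numNodes) : Pt d → ℝ :=
  (R (T.kind K)).shape k ∘ T.chart K

/-- The smooth function on the whole space with which the global approximation agrees on the cell
`K`. -/
noncomputable def PatchData.cellApprox {T : FEMesh R Ω} (P : PatchData T)
    (a : Fin T.numNodes → MultiIdx d p → ℝ) (K : Fin T.numCells) (x : Pt d) : ℝ :=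
  ∑ k, T.localShape K k x *
    scaledPoly (T.node (T.localNode K k)) (P.radius (T.localNode K k)) (a (T.localNode K k)) x

theorem FEMesh.contDiff_localShape (T : FEMesh R Ω) (K : Fin T.numCells)
    (k : Fin (R (T.kind K)).numNodes) {n : ℕ} : ContDiff ℝ n (T.localShape K k) :=
  (((R (T.kind K)).contDiff_shape k).comp (T.contDiff_chart K)).of_le (by exact_mod_cast le_top)

theorem FEMesh.sum_localShape (T : FEMesh R Ω) {K : Fin T.numCells} {x : Pt d}
    (hx : x ∈ T.cell K) : ∑ k, T.localShape K k x = 1 :=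
  (R (T.kind K)).sum_shape _ ((T.bijOn_chart K).mapsTo hx)

theorem PatchData.contDiff_cellApprox {T : FEMesh R Ω} (P : PatchData T)
    (a : Fin T.numNodes → MultiIdx d p → ℝ) (K : Fin T.numCells) {n : ℕ} :
    ContDiff ℝ n (P.cellApprox a K) :=
  ContDiff.sum fun k _ => (T.contDiff_localShape K k).mul (contDiff_scaledPoly _ _ _)

theorem PatchData.globalApprox_eq_cellApprox {T : FEMesh R Ω} (P : PatchData T)
    (a : Fin T.numNodes → MultiIdx d p → ℝ) {K : Fin T.numCells} {x : Pt d}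
    (hx : x ∈ T.cell K) : P.globalApprox a x = P.cellApprox a K x := by
  simp only [PatchData.globalApprox, PatchData.cellApprox]
  rw [← Finset.sum_fiberwise (s := Finset.univ) (g := T.localNode K)]
  refine Finset.sum_congr rfl fun i _ => ?_
  rw [T.shape_eq i K x hx, Finset.sum_mul]
  refine Finset.sum_congr rfl fun k hk => ?_
  rw [(Finset.mem_filter.mp hk).2]
  rfl

/-- Derivatives of the shape functions of order `m` are `O(h^{-m})`, by shape regularity and the
chain rule. -/
theorem exists_norm_iteratedFDeriv_localShape_le [Finite ι] (R : ι → LagrangeCell d)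
    (Ω : Set (Pt d)) (p : ℕ) (κ : ℝ) :
    ∃ C, 0 ≤ C ∧ ∀ T : FEMesh R Ω, T.IsShapeRegular p κ → 0 < T.meshSize →
      ∀ K k, ∀ y ∈ T.cell K, ∀ m ≤ p,
        ‖iteratedFDeriv ℝ m (T.localShape K k) y‖ ≤ C * (T.meshSize⁻¹) ^ m := by
  obtain ⟨C, hC0, hC⟩ := exists_bound_iteratedFDeriv
    (g := fun j : (Σ i, Fin (R i).numNodes) => (R j.1).shape j.2)
    (fun j => (R j.1).contDiff_shape j.2) (K := fun j => (R j.1).carrier)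
    (fun j => (R j.1).isCompact_carrier) p
  refine ⟨p.factorial * C * max κ 1 ^ p, by positivity, fun T hT hh K k y hy m hm => ?_⟩
  have h1 : (1 : ℝ) ≤ max κ 1 := le_max_right _ _
  have h := norm_iteratedFDeriv_comp_le (N := ∞) (n := m) (C := C) (D := max κ 1 * T.meshSize⁻¹)
    ((R (T.kind K)).contDiff_shape k) (T.contDiff_chart K) (by exact_mod_cast le_top) y
    (fun i hi => hC ⟨T.kind K, k⟩ i (hi.trans hm) _ ((T.bijOn_chart K).mapsTo hy))
    (fun i hi him => by
      refine (hT K y hy i hi (him.trans hm)).trans ?_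
      rw [div_eq_mul_inv, mul_pow, inv_pow]
      have : κ ≤ max κ 1 ^ i := (le_max_left κ 1).trans (le_self_pow₀ h1 (by omega))
      gcongr)
  refine h.trans ?_
  rw [mul_pow, ← mul_assoc]
  have hf : (m.factorial : ℝ) ≤ p.factorial := by exact_mod_cast Nat.factorial_le hm
  have hp : max κ 1 ^ m ≤ max κ 1 ^ p := pow_le_pow_right₀ h1 hm
  gcongr

/-- On every closed cell the smooth representative of the global approximation approximates `u`
at the optimal order. Since the shape functions sum to one on the cell, the error is the sum of the
products of shape functions with errors of local reconstructions, and in Leibniz' rule the loss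
`h^{-j}` of a shape function is made up for by the gain `h^j` of the corresponding error. -/
theorem exists_norm_iteratedFDeriv_cellApprox_sub_le [Finite ι] (R : ι → LagrangeCell d)
    (Ω : Set (Pt d)) {u : Pt d → ℝ} (hu : ContDiff ℝ (p + 1 : ℕ) u) {B : ℝ}
    (hB : ∀ x, ‖iteratedFDeriv ℝ (p + 1) u x‖ ≤ B) {κ lam : ℝ} (wmax : ℝ) (M : ℕ)
    (hκ : 0 < κ) (hlam : 0 < lam) :
    ∃ C, ∀ (T : FEMesh R Ω) (P : PatchData T), T.IsShapeRegular p κ →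
      P.IsRegular p κ lam wmax M → 0 < T.meshSize → ∀ a : Fin T.numNodes → MultiIdx d p → ℝ,
        (∀ i, P.IsCWLS i (fun k => u (T.node k)) (a i)) → ∀ K, ∀ y ∈ T.cell K, ∀ n ≤ p,
          ‖iteratedFDeriv ℝ n (P.cellApprox a K - u) y‖ ≤ C * T.meshSize ^ (p + 1 - n) := by
  obtain ⟨C₁, hC₁, hshape⟩ := exists_norm_iteratedFDeriv_localShape_le R Ω p κ
  obtain ⟨C₂, hC₂, hrec⟩ :=
    exists_norm_iteratedFDeriv_scaledPoly_sub_le (R := R) (Ω := Ω) hu hB wmax M hκ hlam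
  obtain ⟨N, hN⟩ := (Set.finite_range fun i => (R i).numNodes).bddAbove
  refine ⟨N * (2 ^ p * (C₁ * C₂)), fun T P hT hP hh a ha K => ?_⟩
  set h := T.meshSize with hdef
  intro y hy n hn
  let E : Fin (R (T.kind K)).numNodes → Pt d → ℝ := fun k =>
    scaledPoly (T.node (T.localNode K k)) (P.radius (T.localNode K k)) (a (T.localNode K k)) - u
  have hun : ContDiff ℝ n u := hu.of_le (by norm_cast; omega)
  have hE : ∀ k, ContDiff ℝ n (E k) := fun k => (contDiff_scaledPoly _ _ _).sub hun
  have hprod : ∀ k, ContDiff ℝ n fun z => T.localShape K k z * E k z :=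
    fun k => (T.contDiff_localShape K k).mul (hE k)
  -- The error formula holds on an open set only in the interior, whose closure is the cell.
  have hclosed : IsClosed {z | ‖iteratedFDeriv ℝ n (P.cellApprox a K - u) z‖ ≤
      N * (2 ^ p * (C₁ * C₂)) * h ^ (p + 1 - n)} :=
    isClosed_le (((P.contDiff_cellApprox a K).sub hun).continuous_iteratedFDeriv le_rfl).norm
      continuous_const
  suffices hint : interior (T.cell K) ⊆ {z | ‖iteratedFDeriv ℝ n (P.cellApprox a K - u) z‖ ≤
      N * (2 ^ p * (C₁ * C₂)) * h ^ (p + 1 - n)} by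
    rw [← T.closure_interior_cell K] at hy
    exact closure_minimal hint hclosed hy
  intro z hz
  have hzK := interior_subset hz
  have heq : P.cellApprox a K - u =ᶠ[𝓝 z] fun z => ∑ k, T.localShape K k z * E k z := by
    filter_upwards [isOpen_interior.mem_nhds hz] with w hw
    simp only [E, Pi.sub_apply, mul_sub, Finset.sum_sub_distrib, ← Finset.sum_mul,
      T.sum_localShape (interior_subset hw), one_mul, PatchData.cellApprox]
  have hterm : ∀ k, ‖iteratedFDeriv ℝ n (fun z => T.localShape K k z * E k z) z‖ ≤
      2 ^ p * (C₁ * C₂) * h ^ (p + 1 - n) := fun k => by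
    have hdist : ‖z - T.node (T.localNode K k)‖ ≤ h := by
      rw [← dist_eq_norm]
      exact (Metric.dist_le_diam_of_mem (T.isCompact_cell K).isBounded hzK
        (T.node_localNode_mem K k)).trans (T.diam_cell_le_meshSize K)
    refine (norm_iteratedFDeriv_mul_le (T.contDiff_localShape K k) (hE k) z le_rfl).trans ?_
    calc ∑ j ∈ Finset.range (n + 1), (n.choose j : ℝ) *
            ‖iteratedFDeriv ℝ j (T.localShape K k) z‖ * ‖iteratedFDeriv ℝ (n - j) (E k) z‖
        ≤ ∑ j ∈ Finset.range (n + 1), (n.choose j : ℝ) * (C₁ * C₂ * h ^ (p + 1 - n)) := by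
          refine Finset.sum_le_sum fun j hj => ?_
          have hj' : j ≤ n := Nat.lt_succ_iff.mp (Finset.mem_range.mp hj)
          have h1 := hshape T hT hh K k z hzK j (hj'.trans hn)
          have h2 := hrec T P hP hh _ _ (ha (T.localNode K k)) z hdist (n - j) (by omega)
          rw [mul_assoc]
          refine mul_le_mul_of_nonneg_left ?_ (Nat.cast_nonneg _)
          refine (mul_le_mul h1 h2 (norm_nonneg _) (by positivity)).trans_eq ?_
          rw [← hdef, show p + 1 - (n - j) = (p + 1 - n) + j by omega, pow_add, inv_pow]
          have : h ^ j ≠ 0 := by positivity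
          field_simp
      _ = 2 ^ n * (C₁ * C₂ * h ^ (p + 1 - n)) := by
          rw [← Finset.sum_mul]
          congr 1
          exact_mod_cast Nat.sum_range_choose n
      _ ≤ 2 ^ p * (C₁ * C₂) * h ^ (p + 1 - n) := by
          rw [← mul_assoc]
          have : (2 : ℝ) ^ n ≤ 2 ^ p := pow_le_pow_right₀ (by norm_num) hn
          gcongr
  change ‖_‖ ≤ _
  rw [(heq.iteratedFDeriv ℝ n).self_of_nhds, iteratedFDeriv_sum (fun k _ => hprod k),
    Finset.sum_apply]
  refine (norm_sum_le_of_le _ fun k _ => hterm k).trans ?_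
  rw [Finset.sum_const, Finset.card_univ, Fintype.card_fin, nsmul_eq_mul, ← mul_assoc]
  have : ((R (T.kind K)).numNodes : ℝ) ≤ N := by exact_mod_cast hN ⟨_, rfl⟩
  gcongr

end Cell

/-! ### Jumps -/

section Jump

variable {d : ℕ}

theorem continuous_multiDeriv {α : Fin d → ℕ} {f : Pt d → ℝ}
    (hf : ContDiff ℝ (∑ i, α i : ℕ) f) : Continuous (multiDeriv α f) :=
  (ContinuousMultilinearMap.apply ℝ (fun _ => Pt d) ℝ _).continuous.comp
    (hf.continuous_iteratedFDeriv le_rfl)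

theorem abs_multiDeriv_sub_le {α : Fin d → ℕ} {f g : Pt d → ℝ}
    (hf : ContDiff ℝ (∑ i, α i : ℕ) f) (hg : ContDiff ℝ (∑ i, α i : ℕ) g) (x : Pt d) :
    |multiDeriv α f x - multiDeriv α g x| ≤ ‖iteratedFDeriv ℝ (∑ i, α i) (f - g) x‖ := by
  rw [multiDeriv, multiDeriv, iteratedFDeriv_sub_apply hf.contDiffAt hg.contDiffAt,
    ← sub_apply, ← Real.norm_eq_abs]
  refine (ContinuousMultilinearMap.le_opNorm _ _).trans ?_
  simp

theorem tendsto_multiDeriv_interior {α : Fin d → ℕ} {f g : Pt d → ℝ} {A : Set (Pt d)}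
    (hg : ContDiff ℝ (∑ i, α i : ℕ) g) (hfg : EqOn f g A) (x : Pt d) :
    Tendsto (multiDeriv α f) (𝓝[interior A] x) (𝓝 (multiDeriv α g x)) := by
  refine ((continuous_multiDeriv hg).continuousWithinAt (s := interior A)).congr' ?_
  filter_upwards [self_mem_nhdsWithin] with y hy
  have h : f =ᶠ[𝓝 y] g := by
    filter_upwards [isOpen_interior.mem_nhds hy] with z hz using hfg (interior_subset hz)
  rw [multiDeriv, multiDeriv, (h.iteratedFDeriv ℝ _).self_of_nhds]

/-- A cell with a boundary point has positive diameter: being the closure of its interior, it also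
has an interior point, and the two are distinct. -/
theorem FEMesh.meshSize_pos {ι : Type*} {R : ι → LagrangeCell d} {Ω : Set (Pt d)} (T : FEMesh R Ω)
    {K : Fin T.numCells} {x : Pt d} (hx : x ∈ frontier (T.cell K)) : 0 < T.meshSize := by
  refine lt_of_lt_of_le ?_ (T.diam_cell_le_meshSize K)
  have hxK : x ∈ T.cell K := (T.isCompact_cell K).isClosed.frontier_subset hx
  have hxi : x ∈ closure (interior (T.cell K)) := by rwa [T.closure_interior_cell K]
  obtain ⟨y, hy⟩ := closure_nonempty_iff.mp ⟨x, hxi⟩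
  have hne : x ≠ y := by
    rintro rfl
    exact hx.2 hy
  exact (dist_pos.2 hne).trans_le
    (Metric.dist_le_diam_of_mem (T.isCompact_cell K).isBounded hxK (interior_subset hy))

end Jump

theorem mainTheorem2 {d p : ℕ} {ι : Type*} [Finite ι] (R : ι → LagrangeCell d)
    (Ω : Set (Pt d)) (hΩ : IsOpen Ω) (hΩb : Bornology.IsBounded Ω)
    (u : Pt d → ℝ)
    (hu : ∃ V : Set (Pt d), IsOpen V ∧ closure Ω ⊆ V ∧ ContDiffOn ℝ ((p + 1 : ℕ) : ℕ∞) u V)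
    (κ lam wmax : ℝ) (M : ℕ) (hκ : 0 < κ) (hlam : 0 < lam) :
    ∃ C : ℝ, ∀ (T : FEMesh R Ω) (P : PatchData T),
      T.IsShapeRegular p κ → P.IsRegular p κ lam wmax M →
      ∀ a : Fin T.numNodes → MultiIdx d p → ℝ,
        (∀ i, P.IsCWLS i (fun k => u (T.node k)) (a i)) →
        ∀ K L : Fin T.numCells, K ≠ L → ∀ α : Fin d → ℕ, ∑ i, α i ≤ p →
          ∀ x ∈ T.interface K L, ∃ J : ℝ,
            HasJump (multiDeriv α (P.globalApprox a)) (T.cell K) (T.cell L) x J ∧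
              |J| ≤ C * T.meshSize ^ (p + 1 - ∑ i, α i) := by
  obtain ⟨V, hV, hΩV, huV⟩ := hu
  obtain ⟨g, hg, hgu, B, hB⟩ := ContDiffOn.exists_global_bounded hV hΩb.isCompact_closure hΩV
    (n := p + 1) (by exact_mod_cast huV)
  obtain ⟨C, hC⟩ := exists_norm_iteratedFDeriv_cellApprox_sub_le R Ω hg hB wmax M hκ hlam
  refine ⟨2 * C, fun T P hT hP a ha K L _ α hα x hx => ?_⟩
  have hh : 0 < T.meshSize := T.meshSize_pos hx.1
  have hdata : (fun k => u (T.node k)) = fun k => g (T.node k) :=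
    funext fun k => (hgu (T.node_mem_closure k)).symm
  rw [hdata] at ha
  have hgα : ContDiff ℝ (∑ i, α i : ℕ) g := hg.of_le (by norm_cast; omega)
  have hclose : ∀ K', x ∈ T.cell K' → |multiDeriv α (P.cellApprox a K') x - multiDeriv α g x| ≤
      C * T.meshSize ^ (p + 1 - ∑ i, α i) := fun K' hx' =>
    (abs_multiDeriv_sub_le (P.contDiff_cellApprox a K') hgα x).trans
      (hC T P hT hP hh a ha K' x hx' _ hα)
  refine ⟨_, ⟨_, _, tendsto_multiDeriv_interior (P.contDiff_cellApprox a K)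
      (fun _ hy => P.globalApprox_eq_cellApprox a hy) x,
    tendsto_multiDeriv_interior (P.contDiff_cellApprox a L)
      (fun _ hy => P.globalApprox_eq_cellApprox a hy) x, rfl⟩, ?_⟩
  have hK := hclose K ((T.isCompact_cell K).isClosed.frontier_subset hx.1)
  have hL := hclose L ((T.isCompact_cell L).isClosed.frontier_subset hx.2)
  have h3 := abs_sub_le (multiDeriv α (P.cellApprox a K) x) (multiDeriv α g x)
    (multiDeriv α (P.cellApprox a L) x)
  rw [abs_sub_comm (multiDeriv α g x)] at h3
  linarith
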